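/- Let $A\in\mathbb{R}^{M\times N}$, $M\ge N$, have the singular value decomposition $A=U\Sigma V^T$ with orthogonal $U=[u_1,\dots,u_M]$, $V=[v_1,\dots,v_N]$ and singular values $\sigma_1,\dots,\sigma_N\ge 0$ labeled so that $|\sigma_1-\tau|\le|\sigma_2-\tau|\le\dots\le|\sigma_N-\tau|$, where $\tau\ge 0$ is a target different from every singular value of $A$. Let $1\le m<N$, $U_m=[u_1,\dots,u_m]$ and $V_m=[v_1,\dots,v_m]$. Write $\sigma_{\max},\sigma_{\min}$ for the largest and smallest singular values of $A$, and $\sigma_{\max,m+1},\sigma_{\min,m+1}$ for its $(m+1)$th largest and $(m+1)$th smallest singular values (counted with multiplicity). Let $\widetilde U_m\in\mathbb{R}^{M\times m}$ and $\widetilde V_m\in\mathbb{R}^{N\times m}$ have orthonormal columns and the same column spaces as $U_m$ and $V_m$, respectively, and consider the preconditioned correction equation $\widetilde B_m w=-r$ with $$\widetilde B_m=\begin{bmatrix}I-\widetilde U_m\widetilde U_m^T&\\&I-\widetilde V_m\widetilde V_m^T\end{bmatrix}\begin{bmatrix}-\tau I&A\\A^T&-\tau I\end{bmatrix}\begin{bmatrix}I-\widetilde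 U_m\widetilde U_m^T&\\&I-\widetilde V_m\widetilde V_m^T\end{bmatrix}.$$ Eigenvalues: for all $\widetilde P_m\in\mathbb{R}^{M\times(M-m)}$ and $\widetilde Q_m\in\mathbb{R}^{N\times(N-m)}$ such that $[\widetilde U_m,\widetilde P_m]$ and $[\widetilde V_m,\widetilde Q_m]$ are orthogonal, one has $\widetilde B_m=\widetilde W_m\widetilde B_m'\widetilde W_m^T$ with $\widetilde W_m=\mathrm{diag}\{\widetilde P_m,\widetilde Q_m\}$ and $$\widetilde B_m'=\begin{bmatrix}-\tau I_{M-m}&\widetilde P_m^TA\widetilde Q_m\\\widetilde Q_m^TA^T\widetilde P_m&-\tau I_{N-m}\end{bmatrix},$$ and the eigenvalues of $\widetilde B_m'$, counted with algebraic multiplicity, are $\pm\sigma_i-\tau$ for $i=m+1,\dots,N$ together with $-\tau$ repeated $M-N$ times. Convergence of MINRES: let $r=(r_1^T,r_2^T)^T\ne 0$ with $\widetilde U_m^Tr_1=0$ and $\widetilde V_m^Tr_2=0$, and for $j=0,1,2,\dots$ let $\tilde w_j$ be the $j$th approximate solution of $\widetilde B_mw=-r$ computed by MINRES with $\tilde w_0=0$,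 that is, a minimizer of $\|\widetilde B_mw+r\|$ over $w\in\mathrm{span}\{r,\widetilde B_mr,\dots,\widetilde B_m^{j-1}r\}$; let $r_{\mathrm{in},j}=\widetilde B_m\tilde w_j+r$. Here $\|\cdot\|$ is the Euclidean norm and $[x]$ the integer part of $x$. Then: (i) if $\tau>(\sigma_{\max}+\sigma_{\max,m+1})/2$, then $$\frac{\|r_{\mathrm{in},j}\|}{\|r\|}\le 2\left(1-\frac{2}{1+\sqrt{(\tau+\sigma_{\max,m+1})/(\tau-\sigma_{\max,m+1})}}\right)^{j};$$ (ii) if $\sigma_{\min}\le\tau<(\sigma_{\min}+\sigma_{\min,m+1})/2$, then, with $j_o=\min\{1,M-N\}$ and with the exponent of the second factor read as $0$ when $j<j_o$, $$\frac{\|r_{\mathrm{in},j}\|}{\|r\|}\le 2\left(\frac{\sigma_{\max}}{\tau}\right)^{j_o}\left(1-\frac{2}{1+\sqrt{(\sigma_{\max}^2-\tau^2)/(\sigma_{\min,m+1}^2-\tau^2)}}\right)^{\left[\frac{j-j_o}{2}\right]};$$ (iii) if $(\sigma_{\min}+\sigma_{\min,m+1})/2<\tau<(\sigma_{\max}+\sigma_{\max,m+1})/2$,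 then $$\frac{\|r_{\mathrm{in},j}\|}{\|r\|}\le 2\left(1-\frac{2}{1+(\sigma_{\max}+\tau)/|\sigma_{m+1}-\tau|}\right)^{\left[\frac{j}{2}\right]}.$$ -/

import Mathlib

open Matrix Polynomial

namespace JDSVD

noncomputable section

/-- The `M × N` matrix with diagonal entries `σ 0, …, σ (N-1)` and zeros elsewhere. -/
def rectDiagonal (M : ℕ) {N : ℕ} (σ : Fin N → ℝ) : Matrix (Fin M) (Fin N) ℝ :=
  Matrix.of fun i j => if (i : ℕ) = (j : ℕ) then σ j else 0

/-- `A = U Σ Vᵀ` is a singular value decomposition: `U` and `V` are square orthogonal matrices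
and the diagonal entries of `Σ`, the singular values of `A`, are nonnegative (in any order). -/
structure IsSVD {M N : ℕ} (A : Matrix (Fin M) (Fin N) ℝ) (U : Matrix (Fin M) (Fin M) ℝ)
    (σ : Fin N → ℝ) (V : Matrix (Fin N) (Fin N) ℝ) : Prop where
  left_orthogonal : U ∈ Matrix.orthogonalGroup (Fin M) ℝ
  right_orthogonal : V ∈ Matrix.orthogonalGroup (Fin N) ℝ
  nonneg : ∀ i, 0 ≤ σ i
  eq_mul : A = U * rectDiagonal M σ * Vᵀ

/-- The entry with (zero-based) position `k` when the values of `σ` are listed, with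
multiplicity, in nondecreasing order: the `(k+1)`-th smallest value. -/
def kthSmallest {N : ℕ} (σ : Fin N → ℝ) (k : Fin N) : ℝ := σ (Tuple.sort σ k)

/-- The entry with (zero-based) position `k` when the values of `σ` are listed, with
multiplicity, in nonincreasing order: the `(k+1)`-th largest value. -/
def kthLargest {N : ℕ} (σ : Fin N → ℝ) (k : Fin N) : ℝ := kthSmallest σ k.rev

/-- The matrix formed by the first `m` columns of `U`. -/
def firstCols {n : ℕ} (U : Matrix (Fin n) (Fin n) ℝ) (m : ℕ) (h : m ≤ n) :
    Matrix (Fin n) (Fin m) ℝ :=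
  U.submatrix id (Fin.castLE h)

/-- The column space of a matrix. -/
def colSpace {n m : ℕ} (X : Matrix (Fin n) (Fin m) ℝ) : Submodule ℝ (Fin n → ℝ) :=
  LinearMap.range X.mulVecLin

/-- The square matrix `[X, Y]` is orthogonal. -/
def IsOrthogonalCompletion {n m p : ℕ} (X : Matrix (Fin n) (Fin m) ℝ)
    (Y : Matrix (Fin n) (Fin p) ℝ) : Prop :=
  (Matrix.fromCols X Y)ᵀ * Matrix.fromCols X Y = 1 ∧
    Matrix.fromCols X Y * (Matrix.fromCols X Y)ᵀ = 1

/-- The shifted augmented matrix `[-τI, A; Aᵀ, -τI]`. -/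
def augmented {m n : ℕ} (τ : ℝ) (A : Matrix (Fin m) (Fin n) ℝ) :
    Matrix (Fin m ⊕ Fin n) (Fin m ⊕ Fin n) ℝ :=
  Matrix.fromBlocks (-τ • 1) A Aᵀ (-τ • 1)

/-- The block diagonal matrix `diag{I - X Xᵀ, I - Y Yᵀ}`. -/
def blockProjector {M N m : ℕ} (X : Matrix (Fin M) (Fin m) ℝ) (Y : Matrix (Fin N) (Fin m) ℝ) :
    Matrix (Fin M ⊕ Fin N) (Fin M ⊕ Fin N) ℝ :=
  Matrix.fromBlocks (1 - X * Xᵀ) 0 0 (1 - Y * Yᵀ)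

/-- The coefficient matrix of the preconditioned correction equation:
`diag{I - X Xᵀ, I - Y Yᵀ} [-τI, A; Aᵀ, -τI] diag{I - X Xᵀ, I - Y Yᵀ}`. -/
def correctionMatrix {M N m : ℕ} (τ : ℝ) (A : Matrix (Fin M) (Fin N) ℝ)
    (X : Matrix (Fin M) (Fin m) ℝ) (Y : Matrix (Fin N) (Fin m) ℝ) :
    Matrix (Fin M ⊕ Fin N) (Fin M ⊕ Fin N) ℝ :=
  blockProjector X Y * augmented τ A * blockProjector X Y

/-- The reduced coefficient matrix `[-τI, PᵀAQ; QᵀAᵀP, -τI]`. -/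
def reducedMatrix {M N p q : ℕ} (τ : ℝ) (A : Matrix (Fin M) (Fin N) ℝ)
    (P : Matrix (Fin M) (Fin p) ℝ) (Q : Matrix (Fin N) (Fin q) ℝ) :
    Matrix (Fin p ⊕ Fin q) (Fin p ⊕ Fin q) ℝ :=
  augmented τ (Pᵀ * A * Q)

/-- The block diagonal matrix `diag{P, Q}`. -/
def blockBasis {M N p q : ℕ} (P : Matrix (Fin M) (Fin p) ℝ) (Q : Matrix (Fin N) (Fin q) ℝ) :
    Matrix (Fin M ⊕ Fin N) (Fin p ⊕ Fin q) ℝ :=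
  Matrix.fromBlocks P 0 0 Q

/-- Double orthogonality `r ⊥⊥ (X, Y)`: the upper part of `r` is orthogonal to the columns of `X`
and the lower part of `r` is orthogonal to the columns of `Y`. -/
def DoublyOrthogonal {M N m : ℕ} (r : EuclideanSpace ℝ (Fin M ⊕ Fin N))
    (X : Matrix (Fin M) (Fin m) ℝ) (Y : Matrix (Fin N) (Fin m) ℝ) : Prop :=
  Xᵀ *ᵥ (fun i => r (Sum.inl i)) = 0 ∧ Yᵀ *ᵥ (fun i => r (Sum.inr i)) = 0

/-- The Krylov subspace `span{b, B b, …, B^(j-1) b}`. -/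
def krylov {ι : Type*} [Fintype ι] [DecidableEq ι] (B : Matrix ι ι ℝ) (b : EuclideanSpace ℝ ι)
    (j : ℕ) : Submodule ℝ (EuclideanSpace ℝ ι) :=
  Submodule.span ℝ (Set.range fun i : Fin j => Matrix.toEuclideanLin (B ^ (i : ℕ)) b)

/-- `x` is the `j`-th approximate solution computed by MINRES for the symmetric linear system
`B x = b` with initial guess `x₀`: it minimizes the Euclidean residual norm over
`x₀ + span{ρ, Bρ, …, B^(j-1) ρ}`, where `ρ = b - B x₀`. -/
def IsMinresIterate {ι : Type*} [Fintype ι] [DecidableEq ι] (B : Matrix ι ι ℝ)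
    (b x₀ : EuclideanSpace ℝ ι) (j : ℕ) (x : EuclideanSpace ℝ ι) : Prop :=
  x - x₀ ∈ krylov B (b - Matrix.toEuclideanLin B x₀) j ∧
    ∀ y : EuclideanSpace ℝ ι, y - x₀ ∈ krylov B (b - Matrix.toEuclideanLin B x₀) j →
      ‖b - Matrix.toEuclideanLin B x‖ ≤ ‖b - Matrix.toEuclideanLin B y‖

/-- MINRES iterates exist at every step. -/
theorem exists_isMinresIterate {ι : Type*} [Fintype ι] [DecidableEq ι] (B : Matrix ι ι ℝ)
    (b x₀ : EuclideanSpace ℝ ι) (j : ℕ) : ∃ x, IsMinresIterate B b x₀ j x := by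
  set ρ := b - Matrix.toEuclideanLin B x₀ with hρ
  obtain ⟨v, ⟨k, hk, rfl⟩, hmin⟩ := (Submodule.closed_of_finiteDimensional
    ((krylov B ρ j).map (Matrix.toEuclideanLin B))).exists_infDist_eq_dist
    ⟨0, Submodule.zero_mem _⟩ ρ
  refine ⟨x₀ + k, by simpa using hk, fun y hy => ?_⟩
  have h1 := Metric.infDist_le_dist_of_mem (x := ρ) (Submodule.mem_map_of_mem
    (f := Matrix.toEuclideanLin B) hy)
  rw [hmin, dist_eq_norm, dist_eq_norm] at h1
  have e1 : b - Matrix.toEuclideanLin B (x₀ + k) = ρ - Matrix.toEuclideanLin B k := by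
    rw [map_add, hρ]; abel
  have e2 : b - Matrix.toEuclideanLin B y = ρ - Matrix.toEuclideanLin B (y - x₀) := by
    rw [map_sub, hρ]; abel
  rw [e1, e2]
  exact h1

end

end JDSVD

namespace JDSVD

/-! Let `W` be the block basis of the complement, so that the coefficient matrix is `W * R * Wᵀ`
with `R` the reduced matrix. Powers intertwine through `W` and `r` lies in the range of `W`, so the
extra eigenvalue `0` on the deflated directions plays no role: the MINRES residual is at most `‖r‖`
times the maximum of `|p|` over the spectrum of `R`, for every polynomial `p` of degree at most `j`
with `p(0) = 1` (`IsMinresIterate.norm_residual_le_of_charpoly`). That spectrum comes from a Schur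
complement (`augmented_charpoly`), applied to the trailing singular vectors. Each bound is then a
choice of `p`: a Chebyshev polynomial (`exists_chebyshev_residual_polynomial`) composed with `-x`,
`(x + τ)² - τ²` or `x²`, which sends the relevant eigenvalues into a positive interval and fixes
`0`. The conditions on `τ` locate the remaining singular values by counting (the `_of_nearest`
lemmas). -/

/-! ### Chebyshev residual polynomials. -/

/-- Scaled and shifted Chebyshev polynomials are small on an interval away from the origin. -/
theorem exists_chebyshev_residual_polynomial {a b : ℝ} (ha : 0 < a) (hab : a ≤ b) (k : ℕ) :
    ∃ q : ℝ[X], q.natDegree ≤ k ∧ q.eval 0 = 1 ∧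
      ∀ x, a ≤ x → x ≤ b → |q.eval x| ≤ 2 * (1 - 2 / (1 + √(b / a))) ^ k := by
  rcases hab.eq_or_lt with rfl | hlt
  · refine ⟨(1 - C a⁻¹ * X) ^ k, ?_, by simp, fun x h1 h2 => ?_⟩
    · have h : (1 - C a⁻¹ * X : ℝ[X]).natDegree ≤ 1 := by compute_degree
      simpa using natDegree_pow_le_of_le k h
    · obtain rfl : x = a := le_antisymm h2 h1
      rw [div_self ha.ne', Real.sqrt_one]
      rcases Nat.eq_zero_or_pos k with rfl | hk
      · norm_num
      · norm_num [ha.ne', hk.ne']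
  have hb : 0 < b := ha.trans hlt
  have hsa : 0 < √a := Real.sqrt_pos.2 ha
  have hsb : √a < √b := Real.sqrt_lt_sqrt ha.le hlt
  have hd : 0 < √b - √a := sub_pos.2 hsb
  have hs : 0 < √b + √a := by linarith
  have hA : √a ^ 2 = a := Real.sq_sqrt ha.le
  have hB : √b ^ 2 = b := Real.sq_sqrt hb.le
  have hba : 0 < b - a := sub_pos.2 hlt
  -- `z` satisfies `cosh (log z) = (b + a) / (b - a)`, the image of `0` under the affine map taking
  -- `[a, b]` to `[-1, 1]` with `a ↦ 1`. Hence `T_k` there is `cosh (k log z) ≥ z ^ k / 2`, and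
  -- `z⁻¹` is the convergence factor.
  set z : ℝ := (√b + √a) / (√b - √a) with hz
  have hz0 : 0 < z := div_pos hs hd
  have hzinv : 1 - 2 / (1 + √(b / a)) = z⁻¹ := by
    rw [Real.sqrt_div hb.le, hz]
    field_simp
    ring
  have hcosh : Real.cosh (Real.log z) = (b + a) / (b - a) := by
    have e1 : b + a = √b ^ 2 + √a ^ 2 := by rw [hA, hB]
    have e2 : b - a = (√b - √a) * (√b + √a) := by linear_combination hA - hB
    rw [Real.cosh_log hz0, hz, e1, e2]
    field_simp
    ring
  set t : ℝ := (Chebyshev.T ℝ k).eval ((b + a) / (b - a)) with ht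
  have htz : z ^ k / 2 ≤ t := by
    rw [ht, ← hcosh, Chebyshev.T_real_cosh, Real.cosh_eq]
    have h1 : Real.exp (((k : ℤ) : ℝ) * Real.log z) = z ^ k := by
      rw [Int.cast_natCast, Real.exp_nat_mul, Real.exp_log hz0]
    rw [h1]
    have := Real.exp_pos (-(((k : ℤ) : ℝ) * Real.log z))
    linarith
  have ht0 : 0 < t := lt_of_lt_of_le (by positivity) htz
  refine ⟨C t⁻¹ * (Chebyshev.T ℝ k).comp (C ((b + a) / (b - a)) - C (2 / (b - a)) * X),
    ?_, ?_, fun x h1 h2 => ?_⟩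
  · refine (natDegree_C_mul_le _ _).trans (natDegree_comp_le.trans ?_)
    rw [Chebyshev.natDegree_T, Int.natAbs_natCast]
    refine (Nat.mul_le_mul_left k (m := 1) ?_).trans (by simp)
    compute_degree
  · simp [eval_comp, ← ht, ht0.ne']
  · have hle : |(Chebyshev.T ℝ k).eval ((b + a) / (b - a) - 2 / (b - a) * x)| ≤ 1 := by
      apply Chebyshev.abs_eval_T_real_le_one
      have : (b + a) / (b - a) - 2 / (b - a) * x = (b + a - 2 * x) / (b - a) := by ring
      rw [this, abs_div, abs_of_pos hba, div_le_one hba, abs_le]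
      constructor <;> linarith
    simp only [eval_mul, eval_C, eval_comp, eval_sub, eval_X]
    rw [abs_mul, abs_of_pos (inv_pos.2 ht0), hzinv, inv_pow]
    calc t⁻¹ * _ ≤ t⁻¹ * 1 := by gcongr
      _ ≤ (z ^ k / 2)⁻¹ := by rw [mul_one]; gcongr
      _ = 2 * (z ^ k)⁻¹ := by rw [inv_div]; rfl

/-! ### Polynomial bounds for MINRES residuals. -/

/-- In an orthonormal eigenbasis `p(R)` multiplies each coordinate by the value of `p` at an
eigenvalue; Parseval does the rest. Using roots of `charpoly` lets the spectrum be read off a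
factorization. -/
theorem norm_aeval_apply_le {ι : Type*} [Fintype ι] [DecidableEq ι] {R : Matrix ι ι ℝ}
    (hR : R.IsHermitian) (p : ℝ[X]) {c : ℝ} (hc : ∀ x, R.charpoly.IsRoot x → |p.eval x| ≤ c)
    (x : EuclideanSpace ℝ ι) : ‖toEuclideanLin (aeval R p) x‖ ≤ c * ‖x‖ := by
  classical
  set e := hR.eigenvectorBasis
  have hroot (i : ι) : |p.eval (hR.eigenvalues i)| ≤ c := by
    apply hc
    rw [hR.charpoly_eq, IsRoot, eval_prod]
    exact Finset.prod_eq_zero (Finset.mem_univ i) (by simp)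
  have hpow (i : ι) (n : ℕ) : (R ^ n) *ᵥ (e i).ofLp = (hR.eigenvalues i) ^ n • (e i).ofLp := by
    induction n with
    | zero => simp
    | succ n ih =>
      rw [pow_succ, ← mulVec_mulVec, hR.mulVec_eigenvectorBasis, mulVec_smul, ih, smul_smul,
        pow_succ']
  have heig (i : ι) : (aeval R p) *ᵥ (e i).ofLp = p.eval (hR.eigenvalues i) • (e i).ofLp := by
    rw [aeval_eq_sum_range, sum_mulVec, eval_eq_sum_range, Finset.sum_smul]
    refine Finset.sum_congr rfl fun n _ => ?_
    rw [smul_mulVec, hpow, smul_smul]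
  have hsymm : (aeval R p)ᵀ = aeval R p := by
    have hRt : Rᵀ = R := by simpa [IsHermitian] using hR
    rw [aeval_eq_sum_range, transpose_sum]
    refine Finset.sum_congr rfl fun n _ => ?_
    rw [transpose_smul, transpose_pow, hRt]
  have hinner (i : ι) : inner ℝ (e i) (toEuclideanLin (aeval R p) x) =
      p.eval (hR.eigenvalues i) * inner ℝ (e i) x := by
    rw [EuclideanSpace.inner_eq_star_dotProduct, EuclideanSpace.inner_eq_star_dotProduct]
    simp only [toLpLin_apply, star_trivial]
    rw [dotProduct_comm, dotProduct_mulVec, ← mulVec_transpose, hsymm, heig, smul_dotProduct,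
      dotProduct_comm, smul_eq_mul]
  -- The sign of `c` comes from some eigenvalue, so the empty index type is separate.
  rcases isEmpty_or_nonempty ι with hι | ⟨⟨i₀⟩⟩
  · rw [Subsingleton.elim (toEuclideanLin (aeval R p) x) 0, Subsingleton.elim x 0]
    simp
  have hc0 : 0 ≤ c := (abs_nonneg _).trans (hroot i₀)
  refine le_of_sq_le_sq ?_ (by positivity)
  rw [mul_pow, ← e.sum_sq_norm_inner_right, ← e.sum_sq_norm_inner_right x, Finset.mul_sum]
  refine Finset.sum_le_sum fun i _ => ?_
  rw [hinner, norm_mul, mul_pow]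
  gcongr
  exact hroot i

theorem norm_toEuclideanLin_of_transpose_mul_self {ι κ : Type*} [Fintype ι] [Fintype κ]
    [DecidableEq κ] {W : Matrix ι κ ℝ} (hW : Wᵀ * W = 1)
    (x : EuclideanSpace ℝ κ) : ‖toEuclideanLin W x‖ = ‖x‖ := by
  rw [← sq_eq_sq₀ (norm_nonneg _) (norm_nonneg _), ← real_inner_self_eq_norm_sq,
    ← real_inner_self_eq_norm_sq, EuclideanSpace.inner_eq_star_dotProduct,
    EuclideanSpace.inner_eq_star_dotProduct]
  simp only [toLpLin_apply, star_trivial]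
  rw [dotProduct_mulVec, ← mulVec_transpose, mulVec_mulVec, hW, one_mulVec]

/-- Writing `p = X * p.divX + 1`, the Krylov vector `y = p.divX(B) r` has residual `B y + r = p(B)
r`, and MINRES does at least as well. -/
theorem IsMinresIterate.norm_residual_le {ι : Type*} [Fintype ι] [DecidableEq ι]
    {B : Matrix ι ι ℝ} {r w : EuclideanSpace ℝ ι} {j : ℕ} (hw : IsMinresIterate B (-r) 0 j w)
    {p : ℝ[X]} (hdeg : p.natDegree ≤ j) (hp : p.eval 0 = 1) :
    ‖toEuclideanLin B w + r‖ ≤ ‖toEuclideanLin (aeval B p) r‖ := by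
  set y : EuclideanSpace ℝ ι := toEuclideanLin (aeval B p.divX) r with hy
  have hrep : aeval B p = B * aeval B p.divX + 1 := by
    conv_lhs => rw [← X_mul_divX_add p]
    simp [coeff_zero_eq_eval_zero, hp]
  have hmem : y ∈ krylov B (-r - toEuclideanLin B 0) j := by
    rw [map_zero, sub_zero, hy, aeval_eq_sum_range, map_sum, LinearMap.sum_apply]
    refine Submodule.sum_mem _ fun n hn => ?_
    rw [map_smul, LinearMap.smul_apply]
    -- The sum always has the term `n = 0`, even when `p.divX = 0` and `j = 0`; only nonzero
    -- coefficients force `n < j`.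
    by_cases h0 : p.divX.coeff n = 0
    · simp [h0]
    refine Submodule.smul_mem _ _ ?_
    have hnj : n < j := by
      have : p.coeff (n + 1) ≠ 0 := by rwa [coeff_divX] at h0
      have := le_natDegree_of_ne_zero this
      omega
    have := Submodule.subset_span (R := ℝ)
      (s := Set.range fun i : Fin j => toEuclideanLin (B ^ (i : ℕ)) (-r)) ⟨⟨n, hnj⟩, rfl⟩
    have h2 := Submodule.neg_mem _ this
    simpa [krylov, map_neg] using h2
  have h := hw.2 y (by simpa using hmem)
  rw [← norm_neg, ← norm_neg (-r - toEuclideanLin B y)] at h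
  have e1 : -(-r - toEuclideanLin B w) = toEuclideanLin B w + r := by abel
  have e2 : -(-r - toEuclideanLin B y) = toEuclideanLin (aeval B p) r := by
    rw [hrep, hy, map_add, LinearMap.add_apply]
    simp [toLpLin_apply]
  rwa [e1, e2] at h

/-- The MINRES residual is controlled by any polynomial on the spectrum of a compression of the
coefficient matrix to a subspace that contains the right-hand side. -/
theorem IsMinresIterate.norm_residual_le_of_charpoly {ι κ : Type*} [Fintype ι] [DecidableEq ι]
    [Fintype κ] [DecidableEq κ] {B : Matrix ι ι ℝ} {W : Matrix ι κ ℝ} {R : Matrix κ κ ℝ}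
    (hW : Wᵀ * W = 1) (hR : R.IsHermitian) (hB : B = W * R * Wᵀ)
    {r w : EuclideanSpace ℝ ι} (hr : (W * Wᵀ) *ᵥ r.ofLp = r.ofLp) {j : ℕ}
    (hw : IsMinresIterate B (-r) 0 j w) {p : ℝ[X]} (hdeg : p.natDegree ≤ j)
    (hp : p.eval 0 = 1) {c : ℝ} (hc : ∀ x, R.charpoly.IsRoot x → |p.eval x| ≤ c) :
    ‖toEuclideanLin B w + r‖ ≤ c * ‖r‖ := by
  set z : EuclideanSpace ℝ κ := WithLp.toLp 2 (Wᵀ *ᵥ r.ofLp) with hz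
  have hrz : r = toEuclideanLin W z := by
    rw [toLpLin_apply, hz]
    simp [mulVec_mulVec, hr]
  have hpow (n : ℕ) : B ^ n * W = W * R ^ n := by
    induction n with
    | zero => simp
    | succ n ih =>
      rw [pow_succ', Matrix.mul_assoc, ih, hB, pow_succ']
      simp only [Matrix.mul_assoc]
      rw [← Matrix.mul_assoc Wᵀ, hW, Matrix.one_mul]
  have hpoly : aeval B p * W = W * aeval R p := by
    rw [aeval_eq_sum_range, aeval_eq_sum_range, Matrix.sum_mul, Matrix.mul_sum]
    refine Finset.sum_congr rfl fun n _ => ?_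
    rw [Matrix.smul_mul, Matrix.mul_smul, hpow]
  have key : toEuclideanLin (aeval B p) r = toEuclideanLin W (toEuclideanLin (aeval R p) z) := by
    rw [hrz]
    simp only [toLpLin_apply, mulVec_mulVec, hpoly]
  calc ‖toEuclideanLin B w + r‖ ≤ ‖toEuclideanLin (aeval B p) r‖ := hw.norm_residual_le hdeg hp
    _ = ‖toEuclideanLin (aeval R p) z‖ := by
      rw [key, norm_toEuclideanLin_of_transpose_mul_self hW]
    _ ≤ c * ‖z‖ := norm_aeval_apply_le hR p hc z
    _ = c * ‖r‖ := by
      conv_rhs => rw [hrz, norm_toEuclideanLin_of_transpose_mul_self hW]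

/-! ### Orthonormal bases, projectors and compressions. -/

/-- Each projector fixes the columns of the other basis; transposing one of these identities shows
that the projectors agree. -/
theorem mul_transpose_eq_of_colSpace_eq {n m : ℕ} {Y Z : Matrix (Fin n) (Fin m) ℝ}
    (hY : Yᵀ * Y = 1) (hZ : Zᵀ * Z = 1) (h : colSpace Y = colSpace Z) :
    Y * Yᵀ = Z * Zᵀ := by
  have aux : ∀ {Y Z : Matrix (Fin n) (Fin m) ℝ}, Zᵀ * Z = 1 → colSpace Y ≤ colSpace Z →
      Z * Zᵀ * Y = Y := by
    intro Y Z hZ h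
    refine Matrix.ext_of_mulVec_single fun i => ?_
    obtain ⟨g, hg⟩ := h ⟨Pi.single i 1, rfl⟩
    simp only [mulVecLin_apply] at hg
    rw [← mulVec_mulVec, ← hg, mulVec_mulVec, Matrix.mul_assoc, hZ, Matrix.mul_one]
  have h1 := aux hZ h.le
  have h2 := aux hY h.ge
  calc Y * Yᵀ = (Z * Zᵀ * Y * Yᵀ)ᵀ := by rw [h1]; simp
    _ = Y * Yᵀ * Z * Zᵀ := by simp [Matrix.mul_assoc]
    _ = Z * Zᵀ := by rw [h2]

/-- The matrix formed by the last `n - m` columns of `U`. -/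
def lastCols {n : ℕ} (U : Matrix (Fin n) (Fin n) ℝ) (m : ℕ) : Matrix (Fin n) (Fin (n - m)) ℝ :=
  U.submatrix id fun i => ⟨m + i, by omega⟩

theorem firstCols_transpose_mul_self {n m : ℕ} {U : Matrix (Fin n) (Fin n) ℝ}
    (hU : U ∈ orthogonalGroup (Fin n) ℝ) (h : m ≤ n) :
    (firstCols U m h)ᵀ * firstCols U m h = 1 := by
  have hU' : Uᵀ * U = 1 := (mem_orthogonalGroup_iff' _ _).1 hU
  ext i k
  have := congrFun (congrFun hU' (Fin.castLE h i)) (Fin.castLE h k)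
  simpa [firstCols, mul_apply, one_apply, Fin.ext_iff] using this

theorem lastCols_transpose_mul_self {n m : ℕ} {U : Matrix (Fin n) (Fin n) ℝ}
    (hU : U ∈ orthogonalGroup (Fin n) ℝ) :
    (lastCols U m)ᵀ * lastCols U m = 1 := by
  have hU' : Uᵀ * U = 1 := (mem_orthogonalGroup_iff' _ _).1 hU
  ext i k
  have := congrFun (congrFun hU' ⟨m + i, by omega⟩) ⟨m + k, by omega⟩
  simpa [lastCols, mul_apply, one_apply, Fin.ext_iff] using this

theorem firstCols_add_lastCols {n m : ℕ} {U : Matrix (Fin n) (Fin n) ℝ}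
    (hU : U ∈ orthogonalGroup (Fin n) ℝ) (h : m ≤ n) :
    firstCols U m h * (firstCols U m h)ᵀ + lastCols U m * (lastCols U m)ᵀ = 1 := by
  have hU' : U * Uᵀ = 1 := (mem_orthogonalGroup_iff _ _).1 hU
  rw [← hU']
  ext i k
  obtain ⟨l, rfl⟩ := Nat.exists_eq_add_of_le h
  simp only [firstCols, lastCols, Matrix.add_apply, mul_apply, submatrix_apply, transpose_apply, id]
  rw [Fin.sum_univ_add]
  congr 1
  exact Fintype.sum_equiv (finCongr (Nat.add_sub_cancel_left (n := m) (m := l))) _ _ fun x => rfl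

theorem lastCols_mul_transpose {n m : ℕ} {U : Matrix (Fin n) (Fin n) ℝ}
    (hU : U ∈ orthogonalGroup (Fin n) ℝ) (h : m ≤ n) {Y : Matrix (Fin n) (Fin m) ℝ}
    (hY : Yᵀ * Y = 1) (hc : colSpace Y = colSpace (firstCols U m h)) :
    lastCols U m * (lastCols U m)ᵀ = 1 - Y * Yᵀ := by
  rw [mul_transpose_eq_of_colSpace_eq hY (firstCols_transpose_mul_self hU h) hc,
    ← firstCols_add_lastCols hU h, add_sub_cancel_left]

theorem IsOrthogonalCompletion.mul_transpose {n m p : ℕ} {Y : Matrix (Fin n) (Fin m) ℝ}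
    {P : Matrix (Fin n) (Fin p) ℝ} (h : IsOrthogonalCompletion Y P) : P * Pᵀ = 1 - Y * Yᵀ := by
  have := h.2
  rw [transpose_fromCols, fromCols_mul_fromRows] at this
  rw [← this, add_sub_cancel_left]

theorem IsOrthogonalCompletion.transpose_mul_self {n m p : ℕ} {Y : Matrix (Fin n) (Fin m) ℝ}
    {P : Matrix (Fin n) (Fin p) ℝ} (h : IsOrthogonalCompletion Y P) : Pᵀ * P = 1 := by
  have := h.1
  rw [transpose_fromCols, fromRows_mul_fromCols, ← fromBlocks_one, fromBlocks_inj] at this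
  exact this.2.2.2

theorem blockBasis_transpose_mul_self {M N p q : ℕ} {P : Matrix (Fin M) (Fin p) ℝ}
    {Q : Matrix (Fin N) (Fin q) ℝ} (hP : Pᵀ * P = 1) (hQ : Qᵀ * Q = 1) :
    (blockBasis P Q)ᵀ * blockBasis P Q = 1 := by
  simp [blockBasis, fromBlocks_transpose, fromBlocks_multiply, hP, hQ]

theorem blockBasis_mul_transpose {M N p q m : ℕ} {P : Matrix (Fin M) (Fin p) ℝ}
    {Q : Matrix (Fin N) (Fin q) ℝ} {Y : Matrix (Fin M) (Fin m) ℝ} {Z : Matrix (Fin N) (Fin m) ℝ}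
    (hP : P * Pᵀ = 1 - Y * Yᵀ) (hQ : Q * Qᵀ = 1 - Z * Zᵀ) :
    blockBasis P Q * (blockBasis P Q)ᵀ = blockProjector Y Z := by
  simp [blockBasis, blockProjector, fromBlocks_transpose, fromBlocks_multiply, hP, hQ]

theorem reducedMatrix_eq {M N p q : ℕ} (τ : ℝ) (A : Matrix (Fin M) (Fin N) ℝ)
    {P : Matrix (Fin M) (Fin p) ℝ} {Q : Matrix (Fin N) (Fin q) ℝ} (hP : Pᵀ * P = 1)
    (hQ : Qᵀ * Q = 1) :
    reducedMatrix τ A P Q = (blockBasis P Q)ᵀ * augmented τ A * blockBasis P Q := by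
  simp [reducedMatrix, augmented, blockBasis, fromBlocks_transpose, fromBlocks_multiply, hP, hQ,
    Matrix.mul_assoc]

theorem correctionMatrix_eq {M N p q m : ℕ} (τ : ℝ) (A : Matrix (Fin M) (Fin N) ℝ)
    {P : Matrix (Fin M) (Fin p) ℝ} {Q : Matrix (Fin N) (Fin q) ℝ} {Y : Matrix (Fin M) (Fin m) ℝ}
    {Z : Matrix (Fin N) (Fin m) ℝ} (hP : Pᵀ * P = 1) (hQ : Qᵀ * Q = 1)
    (hP' : P * Pᵀ = 1 - Y * Yᵀ) (hQ' : Q * Qᵀ = 1 - Z * Zᵀ) :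
    correctionMatrix τ A Y Z = blockBasis P Q * reducedMatrix τ A P Q * (blockBasis P Q)ᵀ := by
  rw [reducedMatrix_eq τ A hP hQ, correctionMatrix, ← blockBasis_mul_transpose hP' hQ']
  simp only [Matrix.mul_assoc]

theorem reducedMatrix_isHermitian {M N p q : ℕ} (τ : ℝ) (A : Matrix (Fin M) (Fin N) ℝ)
    (P : Matrix (Fin M) (Fin p) ℝ) (Q : Matrix (Fin N) (Fin q) ℝ) :
    (reducedMatrix τ A P Q).IsHermitian := by
  simp [IsHermitian, reducedMatrix, augmented, fromBlocks_transpose,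
    conjTranspose_eq_transpose_of_trivial]

/-- Orthonormal bases of the same pair of subspaces give reduced matrices with the same
eigenvalues. -/
theorem reducedMatrix_charpoly_congr {M N p q : ℕ} (τ : ℝ) (A : Matrix (Fin M) (Fin N) ℝ)
    {P P' : Matrix (Fin M) (Fin p) ℝ} {Q Q' : Matrix (Fin N) (Fin q) ℝ} (hP : Pᵀ * P = 1)
    (hQ : Qᵀ * Q = 1) (hP' : P'ᵀ * P' = 1) (hQ' : Q'ᵀ * Q' = 1) (hPP : P * Pᵀ = P' * P'ᵀ)
    (hQQ : Q * Qᵀ = Q' * Q'ᵀ) :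
    (reducedMatrix τ A P Q).charpoly = (reducedMatrix τ A P' Q').charpoly := by
  set W := blockBasis P Q
  set W' := blockBasis P' Q'
  have hW : Wᵀ * W = 1 := blockBasis_transpose_mul_self hP hQ
  have hW' : W'ᵀ * W' = 1 := blockBasis_transpose_mul_self hP' hQ'
  have hWW : W * Wᵀ = W' * W'ᵀ := by
    simp [W, W', blockBasis, fromBlocks_transpose, fromBlocks_multiply, hPP, hQQ]
  -- Inserting this factorization and cycling the product inside `charpoly` avoids having to prove
  -- `W'ᵀ * W` orthogonal.
  have e : W = W' * (W'ᵀ * W) := by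
    rw [← Matrix.mul_assoc, ← hWW, Matrix.mul_assoc, hW, Matrix.mul_one]
  rw [reducedMatrix_eq τ A hP hQ, reducedMatrix_eq τ A hP' hQ']
  change (Wᵀ * augmented τ A * W).charpoly = (W'ᵀ * augmented τ A * W').charpoly
  have e2 : Wᵀ * augmented τ A * W = Wᵀ * augmented τ A * W' * (W'ᵀ * W) := by
    rw [Matrix.mul_assoc _ W', ← e]
  rw [e2, charpoly_mul_comm]
  congr 1
  calc W'ᵀ * W * (Wᵀ * augmented τ A * W') = W'ᵀ * (W * Wᵀ) * augmented τ A * W' := by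
        simp only [Matrix.mul_assoc]
    _ = W'ᵀ * augmented τ A * W' := by
        rw [hWW, ← Matrix.mul_assoc, hW', Matrix.one_mul]

/-! ### Spectrum of the reduced matrix. -/

/-- A Schur complement without inverses: with `y = X + τ`, right multiplication by `[1, E; 0, y]`
makes the characteristic matrix block triangular with diagonal blocks `y` and `y² - EᵀE`. The extra
factor `y ^ q` cancels in the domain `ℝ[X]`. -/
theorem augmented_charpoly {p q : ℕ} (hqp : q ≤ p) (τ : ℝ) {D : Matrix (Fin p) (Fin q) ℝ}
    {s : Fin q → ℝ} (hD : Dᵀ * D = diagonal fun i => s i ^ 2) :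
    (augmented τ D).charpoly =
      (∏ i, (X - C (s i - τ)) * (X - C (-s i - τ))) * (X - C (-τ)) ^ (p - q) := by
  set y : ℝ[X] := X - C (-τ) with hy
  have hy0 : y ≠ 0 := X_sub_C_ne_zero _
  set E : Matrix (Fin p) (Fin q) ℝ[X] := D.map C with hE
  have hEE : Eᵀ * E = diagonal fun i => C (s i) ^ 2 := by
    rw [hE, ← transpose_map, ← Matrix.map_mul, hD]
    ext i k
    simp only [map_apply, diagonal_apply]
    split_ifs <;> simp
  have hchar : charmatrix (augmented τ D) = fromBlocks (y • 1) (-E) (-Eᵀ) (y • 1) := by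
    rw [augmented, charmatrix_fromBlocks]
    have hdiag (n : ℕ) : charmatrix ((-τ) • (1 : Matrix (Fin n) (Fin n) ℝ)) =
        y • (1 : Matrix (Fin n) (Fin n) ℝ[X]) := by
      ext i k
      by_cases h : i = k
      · subst h; simp [hy]
      · simp [h]
    rw [hdiag, hdiag, hE, transpose_map]
  have hmul : fromBlocks (y • 1) (-E) (-Eᵀ) (y • 1) * fromBlocks 1 E 0 (y • 1) =
      fromBlocks (y • 1) 0 (-Eᵀ) (diagonal fun i => y ^ 2 - C (s i) ^ 2) := by
    rw [fromBlocks_multiply]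
    simp [hEE, smul_smul]
    refine Matrix.ext fun i k => ?_
    by_cases h : i = k
    · subst h; simp; ring
    · simp [h]
  have hdet := congrArg det hmul
  rw [det_mul, ← hchar, det_fromBlocks_zero₂₁, det_fromBlocks_zero₁₂, det_one, one_mul,
    det_smul, det_smul, det_one, det_one, mul_one, mul_one, det_diagonal, Fintype.card_fin,
    Fintype.card_fin] at hdet
  have hpow : y ^ p = y ^ (p - q) * y ^ q := by rw [← pow_add, Nat.sub_add_cancel hqp]
  have : (augmented τ D).charpoly * y ^ q =
      ((∏ i, (y ^ 2 - C (s i) ^ 2)) * y ^ (p - q)) * y ^ q := by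
    rw [charpoly, hdet, hpow]; ring
  rw [mul_right_cancel₀ (pow_ne_zero q hy0) this]
  congr 1
  refine Finset.prod_congr rfl fun i _ => ?_
  simp only [hy, C_sub, C_neg]
  ring

theorem lastCols_transpose_mul_mul {M N m : ℕ} {A : Matrix (Fin M) (Fin N) ℝ}
    {U : Matrix (Fin M) (Fin M) ℝ} {σ : Fin N → ℝ} {V : Matrix (Fin N) (Fin N) ℝ}
    (hA : IsSVD A U σ V) :
    (lastCols U m)ᵀ * A * lastCols V m =
      rectDiagonal (M - m) fun i : Fin (N - m) => σ ⟨m + i, by omega⟩ := by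
  have hU : Uᵀ * U = 1 := (mem_orthogonalGroup_iff' _ _).1 hA.left_orthogonal
  have hV : Vᵀ * V = 1 := (mem_orthogonalGroup_iff' _ _).1 hA.right_orthogonal
  have h : Uᵀ * A * V = rectDiagonal M σ := by
    rw [hA.eq_mul]
    calc _ = (Uᵀ * U) * rectDiagonal M σ * (Vᵀ * V) := by simp only [Matrix.mul_assoc]
      _ = _ := by rw [hU, hV, Matrix.one_mul, Matrix.mul_one]
  ext i k
  have := congrFun (congrFun h ⟨m + i, by omega⟩) ⟨m + k, by omega⟩
  simpa [lastCols, rectDiagonal, mul_apply] using this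

theorem rectDiagonal_transpose_mul_self {p q : ℕ} (hqp : q ≤ p) (s : Fin q → ℝ) :
    (rectDiagonal p s)ᵀ * rectDiagonal p s = diagonal fun i => s i ^ 2 := by
  ext i k
  simp only [mul_apply, transpose_apply, rectDiagonal, of_apply, diagonal_apply]
  rw [Finset.sum_eq_single (⟨i, by omega⟩ : Fin p)]
  · by_cases h : i = k
    · subst h; simp [sq]
    · simp [h, Fin.ext_iff.not.1 h]
  · intro b _ hb
    have : (b : ℕ) ≠ i := fun h => hb (Fin.ext h)
    simp [this]
  · simp

theorem reducedMatrix_lastCols_charpoly {M N m : ℕ} (hNM : N ≤ M)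
    {A : Matrix (Fin M) (Fin N) ℝ}
    {U : Matrix (Fin M) (Fin M) ℝ} {σ : Fin N → ℝ} {V : Matrix (Fin N) (Fin N) ℝ}
    (hA : IsSVD A U σ V) (hmN : m ≤ N) (τ : ℝ) :
    (reducedMatrix τ A (lastCols U m) (lastCols V m)).charpoly =
      (∏ i ∈ Finset.univ.filter (fun i : Fin N => m ≤ (i : ℕ)),
        (X - C (σ i - τ)) * (X - C (-σ i - τ))) * (X - C (-τ)) ^ (M - N) := by
  rw [reducedMatrix, lastCols_transpose_mul_mul hA, augmented_charpoly (by omega) τ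
    (rectDiagonal_transpose_mul_self (by omega) _)]
  congr 1
  · refine Finset.prod_bij' (fun i _ => (⟨m + i, by omega⟩ : Fin N))
      (fun i hi => (⟨i - m, by have := (Finset.mem_filter.1 hi).2; omega⟩ : Fin (N - m)))
      ?_ ?_ ?_ ?_ ?_
    · simp
    · simp
    · simp
    · intro i hi
      have := (Finset.mem_filter.1 hi).2
      ext
      simp
      omega
    · simp
  · congr 1
    omega

/-! ### Order statistics and labeling by distance to the target. -/

theorem kthSmallest_zero_le {N : ℕ} (σ : Fin N → ℝ) (h : 0 < N) (i : Fin N) :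
    kthSmallest σ ⟨0, h⟩ ≤ σ i := by
  have := Tuple.monotone_sort σ (show ⟨0, h⟩ ≤ (Tuple.sort σ).symm i from Nat.zero_le _)
  simpa [kthSmallest] using this

theorem le_kthLargest_zero {N : ℕ} (σ : Fin N → ℝ) (h : 0 < N) (i : Fin N) :
    σ i ≤ kthLargest σ ⟨0, h⟩ := by
  have := Tuple.monotone_sort σ (show (Tuple.sort σ).symm i ≤ Fin.rev ⟨0, h⟩ by
    rw [Fin.le_def, Fin.val_rev]; dsimp only; omega)
  simpa [kthLargest, kthSmallest] using this

/-- Sorting is monotone, so these indices occupy sorted positions before `k`; ties can only lower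
the count. -/
theorem card_lt_kthSmallest_le {N : ℕ} (σ : Fin N → ℝ) (k : Fin N) :
    (Finset.univ.filter fun i => σ i < kthSmallest σ k).card ≤ k := by
  rw [← Fin.card_Iio k, ← Finset.card_map (s := Finset.Iio k) (Tuple.sort σ).toEmbedding]
  refine Finset.card_le_card fun i hi => ?_
  rw [Finset.mem_map_equiv, Finset.mem_Iio]
  by_contra h
  have := Tuple.monotone_sort σ (not_lt.1 h)
  simp only [Function.comp_apply, Equiv.apply_symm_apply] at this
  exact (Finset.mem_filter.1 hi).2.not_ge this

theorem card_kthLargest_lt_le {N : ℕ} (σ : Fin N → ℝ) (k : Fin N) :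
    (Finset.univ.filter fun i => kthLargest σ k < σ i).card ≤ k := by
  have hk : (Finset.Ioi k.rev).card = k := by
    rw [Fin.card_Ioi, Fin.val_rev]; omega
  rw [← hk, ← Finset.card_map (s := Finset.Ioi k.rev) (Tuple.sort σ).toEmbedding]
  refine Finset.card_le_card fun i hi => ?_
  rw [Finset.mem_map_equiv, Finset.mem_Ioi]
  by_contra h
  have := Tuple.monotone_sort σ (not_lt.1 h)
  simp only [Function.comp_apply, Equiv.apply_symm_apply] at this
  exact (Finset.mem_filter.1 hi).2.not_ge this

theorem lt_card_le_kthSmallest {N : ℕ} (σ : Fin N → ℝ) (k : Fin N) :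
    (k : ℕ) < (Finset.univ.filter fun i => σ i ≤ kthSmallest σ k).card := by
  rw [Nat.lt_iff_add_one_le, ← Fin.card_Iic k, ← Finset.card_map (Tuple.sort σ).toEmbedding]
  refine Finset.card_le_card fun i hi => ?_
  rw [Finset.mem_map_equiv, Finset.mem_Iic] at hi
  have := Tuple.monotone_sort σ hi
  simp only [Function.comp_apply, Equiv.apply_symm_apply] at this
  exact Finset.mem_filter.2 ⟨Finset.mem_univ _, this⟩

variable {N m : ℕ} {σ : Fin N → ℝ} {τ : ℝ}

/-- If the target lies above the midpoint of the largest and the `(m+1)`-th largest value, the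
values that are not among the `m` nearest to the target are at most the `(m+1)`-th largest. -/
theorem le_kthLargest_of_nearest (hσ : ∀ i k : Fin N, i ≤ k → |σ i - τ| ≤ |σ k - τ|)
    (h : 0 < N) (hm : m < N)
    (hτ : (kthLargest σ ⟨0, h⟩ + kthLargest σ ⟨m, hm⟩) / 2 < τ) {i : Fin N} (hi : m ≤ i) :
    σ i ≤ kthLargest σ ⟨m, hm⟩ := by
  by_contra! hlt
  have hmax := le_kthLargest_zero σ h
  -- The upper side uses `σ i ≤ σmax` and the midpoint condition: `σmax - τ < τ - σmaxm`.
  have h1 : |σ i - τ| < τ - kthLargest σ ⟨m, hm⟩ := by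
    rw [abs_lt]; constructor <;> linarith [hmax i]
  -- All `i + 1 ≥ m + 1` labels up to `i` are at least as near to `τ`, so they too exceed a value
  -- that at most `m` entries exceed.
  have hsub : Finset.Iic i ⊆ Finset.univ.filter fun k => kthLargest σ ⟨m, hm⟩ < σ k := by
    intro k hk
    have h2 := (hσ k i (Finset.mem_Iic.1 hk)).trans_lt h1
    rw [abs_lt] at h2
    exact Finset.mem_filter.2 ⟨Finset.mem_univ _, by linarith⟩
  have := (Finset.card_le_card hsub).trans (card_kthLargest_lt_le σ _)
  rw [Fin.card_Iic] at this
  dsimp only at this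
  omega

/-- Mirror image of `le_kthLargest_of_nearest`. -/
theorem kthSmallest_le_of_nearest (hσ : ∀ i k : Fin N, i ≤ k → |σ i - τ| ≤ |σ k - τ|)
    (h : 0 < N) (hm : m < N)
    (hτ : τ < (kthSmallest σ ⟨0, h⟩ + kthSmallest σ ⟨m, hm⟩) / 2) {i : Fin N} (hi : m ≤ i) :
    kthSmallest σ ⟨m, hm⟩ ≤ σ i := by
  by_contra! hlt
  have hmin := kthSmallest_zero_le σ h
  have h1 : |σ i - τ| < kthSmallest σ ⟨m, hm⟩ - τ := by
    rw [abs_lt]; constructor <;> linarith [hmin i]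
  have hsub : Finset.Iic i ⊆ Finset.univ.filter fun k => σ k < kthSmallest σ ⟨m, hm⟩ := by
    intro k hk
    have h2 := (hσ k i (Finset.mem_Iic.1 hk)).trans_lt h1
    rw [abs_lt] at h2
    exact Finset.mem_filter.2 ⟨Finset.mem_univ _, by linarith⟩
  have := (Finset.card_le_card hsub).trans (card_lt_kthSmallest_le σ _)
  rw [Fin.card_Iic] at this
  dsimp only at this
  omega

/-- If the nonnegative target lies above the midpoint of the smallest and the `(m+1)`-th smallest
value, then at least `m + 1` values are no farther from the target than the origin is. -/
theorem abs_sub_le_of_nearest (hσ : ∀ i k : Fin N, i ≤ k → |σ i - τ| ≤ |σ k - τ|)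
    (h0 : ∀ i, 0 ≤ σ i) (h : 0 < N) (hm : m < N)
    (hτ : (kthSmallest σ ⟨0, h⟩ + kthSmallest σ ⟨m, hm⟩) / 2 < τ) :
    |σ ⟨m, hm⟩ - τ| ≤ τ := by
  -- Pigeonhole: at least `m + 1` entries are this small and only `m` labels precede `m`. The entry
  -- found lies in `[0, 2τ]`, and label `m` is no farther from `τ`.
  obtain ⟨k, hk, hmk⟩ : ∃ k, σ k ≤ kthSmallest σ ⟨m, hm⟩ ∧ m ≤ (k : ℕ) := by
    by_contra! hcon
    have hsub : (Finset.univ.filter fun k => σ k ≤ kthSmallest σ ⟨m, hm⟩) ⊆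
        Finset.Iio ⟨m, hm⟩ := fun k hk =>
      Finset.mem_Iio.2 (hcon k (Finset.mem_filter.1 hk).2)
    have := (lt_card_le_kthSmallest σ ⟨m, hm⟩).trans_le (Finset.card_le_card hsub)
    rw [Fin.card_Iio] at this
    exact lt_irrefl _ this
  refine (hσ ⟨m, hm⟩ k hmk).trans ?_
  have hmin : 0 ≤ kthSmallest σ ⟨0, h⟩ := h0 _
  rw [abs_le]
  constructor <;> linarith [h0 k]

end JDSVD

/-! ### Factorization, spectrum and the three convergence bounds. -/

theorem theorem7 {M N m : ℕ} (hNM : N ≤ M) (hm : 1 ≤ m) (hmN : m < N)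
    -- the matrix, its SVD, and the target
    (A : Matrix (Fin M) (Fin N) ℝ) (U : Matrix (Fin M) (Fin M) ℝ) (σ : Fin N → ℝ)
    (V : Matrix (Fin N) (Fin N) ℝ) (hA : JDSVD.IsSVD A U σ V)
    (τ : ℝ) (hτ : 0 ≤ τ) (hτσ : ∀ i, σ i ≠ τ)
    -- the singular values are labeled by their distance to the target
    (hσ : ∀ i k : Fin N, i ≤ k → |σ i - τ| ≤ |σ k - τ|)
    -- the approximate singular vectors
    (Um : Matrix (Fin M) (Fin m) ℝ) (Vm : Matrix (Fin N) (Fin m) ℝ)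
    (hUm : Umᵀ * Um = 1) (hVm : Vmᵀ * Vm = 1)
    (hRU : JDSVD.colSpace Um = JDSVD.colSpace (JDSVD.firstCols U m (hmN.le.trans hNM)))
    (hRV : JDSVD.colSpace Vm = JDSVD.colSpace (JDSVD.firstCols V m hmN.le))
    -- extreme singular values, and the ones with number `m + 1` from the top and the bottom
    (σmax σmin σmaxm σminm : ℝ)
    (hσmax : σmax = JDSVD.kthLargest σ ⟨0, Nat.zero_lt_of_lt hmN⟩)
    (hσmin : σmin = JDSVD.kthSmallest σ ⟨0, Nat.zero_lt_of_lt hmN⟩)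
    (hσmaxm : σmaxm = JDSVD.kthLargest σ ⟨m, hmN⟩)
    (hσminm : σminm = JDSVD.kthSmallest σ ⟨m, hmN⟩) :
    -- the coefficient matrix restricted to the complement and its eigenvalues
    (∀ (P : Matrix (Fin M) (Fin (M - m)) ℝ) (Q : Matrix (Fin N) (Fin (N - m)) ℝ),
      JDSVD.IsOrthogonalCompletion Um P → JDSVD.IsOrthogonalCompletion Vm Q →
        JDSVD.correctionMatrix τ A Um Vm =
            JDSVD.blockBasis P Q * JDSVD.reducedMatrix τ A P Q * (JDSVD.blockBasis P Q)ᵀ ∧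
          (JDSVD.reducedMatrix τ A P Q).charpoly =
            (∏ i ∈ Finset.univ.filter (fun i : Fin N => m ≤ (i : ℕ)),
              (X - C (σ i - τ)) * (X - C (-σ i - τ))) * (X - C (-τ)) ^ (M - N)) ∧
    -- convergence of MINRES with zero initial guess
    (∀ r : EuclideanSpace ℝ (Fin M ⊕ Fin N), r ≠ 0 → JDSVD.DoublyOrthogonal r Um Vm →
      ∀ (j : ℕ) (w : EuclideanSpace ℝ (Fin M ⊕ Fin N)),
        JDSVD.IsMinresIterate (JDSVD.correctionMatrix τ A Um Vm) (-r) 0 j w →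
          ((σmax + σmaxm) / 2 < τ →
            ‖Matrix.toEuclideanLin (JDSVD.correctionMatrix τ A Um Vm) w + r‖ / ‖r‖ ≤
              2 * (1 - 2 / (1 + √((τ + σmaxm) / (τ - σmaxm)))) ^ j) ∧
          (σmin ≤ τ → τ < (σmin + σminm) / 2 →
            ‖Matrix.toEuclideanLin (JDSVD.correctionMatrix τ A Um Vm) w + r‖ / ‖r‖ ≤
              2 * (σmax / τ) ^ (min 1 (M - N)) *
                (1 - 2 / (1 + √((σmax ^ 2 - τ ^ 2) / (σminm ^ 2 - τ ^ 2)))) ^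
                  ((j - min 1 (M - N)) / 2)) ∧
          ((σmin + σminm) / 2 < τ → τ < (σmax + σmaxm) / 2 →
            ‖Matrix.toEuclideanLin (JDSVD.correctionMatrix τ A Um Vm) w + r‖ / ‖r‖ ≤
              2 * (1 - 2 / (1 + (σmax + τ) / |σ ⟨m, hmN⟩ - τ|)) ^ (j / 2))) := by
  have hP : (JDSVD.lastCols U m)ᵀ * JDSVD.lastCols U m = 1 :=
    JDSVD.lastCols_transpose_mul_self hA.left_orthogonal
  have hQ : (JDSVD.lastCols V m)ᵀ * JDSVD.lastCols V m = 1 :=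
    JDSVD.lastCols_transpose_mul_self hA.right_orthogonal
  have hPP := JDSVD.lastCols_mul_transpose hA.left_orthogonal _ hUm hRU
  have hQQ := JDSVD.lastCols_mul_transpose hA.right_orthogonal _ hVm hRV
  have hchar := JDSVD.reducedMatrix_lastCols_charpoly hNM hA hmN.le τ
  refine ⟨fun P Q hUP hVQ => ⟨JDSVD.correctionMatrix_eq τ A hUP.transpose_mul_self
    hVQ.transpose_mul_self hUP.mul_transpose hVQ.mul_transpose, ?_⟩, ?_⟩
  -- Any completion has the same projectors as the trailing singular vectors, for which the
  -- compression of `A` is diagonal.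
  · rw [← hchar]
    exact JDSVD.reducedMatrix_charpoly_congr τ A hUP.transpose_mul_self hVQ.transpose_mul_self hP hQ
      (hUP.mul_transpose.trans hPP.symm) (hVQ.mul_transpose.trans hQQ.symm)
  intro r hr0 hr j w hw
  have hN : 0 < N := Nat.zero_lt_of_lt hmN
  have hrnorm : 0 < ‖r‖ := norm_pos_iff.2 hr0
  have hproj : (JDSVD.blockBasis (JDSVD.lastCols U m) (JDSVD.lastCols V m) *
      (JDSVD.blockBasis (JDSVD.lastCols U m) (JDSVD.lastCols V m))ᵀ) *ᵥ r.ofLp = r.ofLp := by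
    have hr' : r.ofLp = Sum.elim (fun i => r (Sum.inl i)) (fun i => r (Sum.inr i)) := by
      ext (i | i) <;> rfl
    rw [JDSVD.blockBasis_mul_transpose hPP hQQ, hr', JDSVD.blockProjector, fromBlocks_mulVec]
    simp only [Sum.elim_comp_inl, Sum.elim_comp_inr, sub_mulVec, one_mulVec, zero_mulVec,
      ← mulVec_mulVec, hr.1, hr.2, mulVec_zero, sub_zero, add_zero, zero_add]
  -- Each bound reduces to estimating `p` on the spectrum; `-τ` counts as an extra eigenvalue only
  -- for `M ≠ N`.
  have key {p : ℝ[X]} (hdeg : p.natDegree ≤ j) (hp : p.eval 0 = 1) {c : ℝ}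
      (hc : ∀ i : Fin N, m ≤ (i : ℕ) → |p.eval (σ i - τ)| ≤ c ∧ |p.eval (-σ i - τ)| ≤ c)
      (hc' : M ≠ N → |p.eval (-τ)| ≤ c) :
      ‖Matrix.toEuclideanLin (JDSVD.correctionMatrix τ A Um Vm) w + r‖ / ‖r‖ ≤ c := by
    rw [div_le_iff₀ hrnorm]
    refine hw.norm_residual_le_of_charpoly (JDSVD.blockBasis_transpose_mul_self hP hQ)
      (JDSVD.reducedMatrix_isHermitian τ A _ _) (JDSVD.correctionMatrix_eq τ A hP hQ hPP hQQ)
      hproj hdeg hp fun x hx => ?_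
    rw [hchar, IsRoot, eval_mul, mul_eq_zero, eval_prod, Finset.prod_eq_zero_iff] at hx
    rcases hx with ⟨i, hi, hx⟩ | hx
    · simp only [eval_mul, eval_sub, eval_X, eval_C, mul_eq_zero, sub_eq_zero] at hx
      rcases hx with rfl | rfl
      · exact (hc i (Finset.mem_filter.1 hi).2).1
      · exact (hc i (Finset.mem_filter.1 hi).2).2
    · rw [eval_pow, pow_eq_zero_iff', eval_sub, eval_X, eval_C, sub_eq_zero] at hx
      obtain ⟨rfl, hx⟩ := hx
      exact hc' fun h => hx (by omega)
  have hmax (i : Fin N) : σ i ≤ σmax := hσmax ▸ JDSVD.le_kthLargest_zero σ hN i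
  have hnn := hA.nonneg
  refine ⟨fun h => ?_, fun h1 h2 => ?_, fun h1 h2 => ?_⟩
  -- Here the spectrum is negative, inside `[-τ - σmaxm, -τ + σmaxm]`, so `x ↦ -x` suffices.
  · have hle {i : Fin N} (hi : m ≤ (i : ℕ)) : σ i ≤ σmaxm := by
      subst hσmax hσmaxm
      exact JDSVD.le_kthLargest_of_nearest hσ hN hmN h hi
    have hm0 : 0 ≤ σmaxm := hσmaxm ▸ hnn _
    have hmm : σmaxm ≤ σmax := hσmaxm ▸ hmax _
    obtain ⟨q, hq, hq0, hqb⟩ := JDSVD.exists_chebyshev_residual_polynomial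
      (a := τ - σmaxm) (b := τ + σmaxm) (by linarith) (by linarith) j
    refine key (p := q.comp (-X)) ?_ (by simp [hq0]) (fun i hi => ?_) (fun _ => ?_)
    · rwa [natDegree_comp, natDegree_neg, natDegree_X, mul_one]
    · have := hle hi
      have := hnn i
      simp only [eval_comp, eval_neg, eval_X]
      constructor <;> apply hqb <;> linarith
    · simp only [eval_comp, eval_neg, eval_X]
      apply hqb <;> linarith
  · have hge {i : Fin N} (hi : m ≤ (i : ℕ)) : σminm ≤ σ i := by
      subst hσmin hσminm
      exact JDSVD.kthSmallest_le_of_nearest hσ hN hmN h2 hi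
    have hmin0 : 0 ≤ σmin := hσmin ▸ hnn _
    -- Since `τ` is no singular value the inequality is strict, which makes `τ` positive.
    have hτmin : σmin < τ := lt_of_le_of_ne h1 (hσmin ▸ hτσ _)
    have hτ0 : 0 < τ := hmin0.trans_lt hτmin
    have hτm : τ < σminm := by linarith
    have hmm : σminm ≤ σmax := hσminm ▸ hmax _
    have hτx : 1 ≤ σmax / τ := by rw [one_le_div hτ0]; linarith
    have hm0 : 0 ≤ σminm := by linarith
    have hab : σminm ^ 2 ≤ σmax ^ 2 := by gcongr
    have ha : τ ^ 2 < σminm ^ 2 := by gcongr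
    set d := min 1 (M - N) with hd
    obtain ⟨q, hq, hq0, hqb⟩ := JDSVD.exists_chebyshev_residual_polynomial
      (a := σminm ^ 2 - τ ^ 2) (b := σmax ^ 2 - τ ^ 2) (by linarith) (by linarith) ((j - d) / 2)
    -- When `j < d` the truncated exponent is `0`, and `p = 1` suffices because `σmax / τ ≥ 1`.
    rcases Nat.lt_or_ge j d with hjd | hjd
    · have hone : (1 : ℝ) ≤ 2 * (σmax / τ) ^ d := by
        have := one_le_pow₀ hτx (n := d)
        linarith
      rw [Nat.sub_eq_zero_of_le hjd.le]
      refine key (p := 1) (by simp) (by simp) (fun i hi => ?_) (fun _ => ?_) <;>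
        simpa using hone
    have hsq {i : Fin N} (hi : m ≤ (i : ℕ)) :
        σminm ^ 2 ≤ σ i ^ 2 ∧ σ i ^ 2 ≤ σmax ^ 2 :=
      ⟨by have := hge hi; gcongr, by have := hmax i; have := hnn i; gcongr⟩
    -- The quadratic equals `(x + τ)² - τ²`, so `±σ i - τ` both map to `σ i ^ 2 - τ ^ 2`. The
    -- eigenvalue `-τ` maps to `-τ²`, outside the interval; the factor `1 + x / τ` kills it, at the
    -- price of one degree and of `σ i / τ ≤ σmax / τ` elsewhere.
    refine key (p := (1 + C τ⁻¹ * X) ^ d * q.comp (X ^ 2 + C (2 * τ) * X)) ?_ (by simp [hq0])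
      (fun i hi => ?_) (fun hMN => ?_)
    · have e1 : (1 + C τ⁻¹ * X : ℝ[X]).natDegree ≤ 1 := by compute_degree
      have e2 : (X ^ 2 + C (2 * τ) * X : ℝ[X]).natDegree ≤ 2 := by compute_degree
      have e3 := natDegree_pow_le_of_le d e1
      have e4 : (q.comp (X ^ 2 + C (2 * τ) * X)).natDegree ≤ (j - d) / 2 * 2 :=
        natDegree_comp_le.trans (Nat.mul_le_mul hq e2)
      have := natDegree_mul_le_of_le e3 e4
      omega
    · obtain ⟨hs1, hs2⟩ := hsq hi
      have hbound (x : ℝ) (hx : (x + τ) ^ 2 = σ i ^ 2) :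
          |eval x ((1 + C τ⁻¹ * X) ^ d * q.comp (X ^ 2 + C (2 * τ) * X))| ≤
            2 * (σmax / τ) ^ d * (1 - 2 / (1 + √((σmax ^ 2 - τ ^ 2) / (σminm ^ 2 - τ ^ 2)))) ^
                  ((j - d) / 2) := by
        have hxa : |1 + τ⁻¹ * x| ≤ σmax / τ := by
          have e : 1 + τ⁻¹ * x = (x + τ) / τ := by field_simp; ring
          rw [e, abs_div, abs_of_pos hτ0, (sq_eq_sq_iff_abs_eq_abs _ _).1 hx, abs_of_nonneg (hnn i)]
          have := hmax i
          gcongr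
        have hq' := hqb (x ^ 2 + 2 * τ * x) (by linarith) (by linarith)
        simp only [eval_mul, eval_pow, eval_add, eval_one, eval_C, eval_X, eval_comp]
        rw [abs_mul, abs_pow]
        refine (mul_le_mul (pow_le_pow_left₀ (abs_nonneg _) hxa d) hq' (abs_nonneg _)
          (pow_nonneg (zero_le_one.trans hτx) d)).trans_eq ?_
        ring
      exact ⟨hbound _ (by ring), hbound _ (by ring)⟩
    · have hd1 : d = 1 := by omega
      have : eval (-τ) ((1 + C τ⁻¹ * X) ^ d * q.comp (X ^ 2 + C (2 * τ) * X)) = 0 := by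
        simp [hd1, hτ0.ne']
      rw [this, abs_zero]
      have hfac := (abs_nonneg _).trans (hqb _ le_rfl (by linarith))
      have := mul_nonneg (pow_nonneg (zero_le_one.trans hτx) d) hfac
      linarith
  · set δ := |σ ⟨m, hmN⟩ - τ| with hδ
    have hδ0 : 0 < δ := abs_pos.2 (sub_ne_zero.2 (hτσ _))
    -- This keeps `-τ` and `-σ i - τ` out of the gap `(-δ, δ)`, so squaring sends the whole spectrum
    -- into `[δ², (σmax + τ)²]`.
    have hδτ : δ ≤ τ := by
      subst hσmin hσminm
      exact JDSVD.abs_sub_le_of_nearest hσ hnn hN hmN h1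
    have hx0 : 0 ≤ σmax := (hnn ⟨0, hN⟩).trans (hmax _)
    have hb0 : 0 ≤ σmax + τ := by linarith
    obtain ⟨q, hq, hq0, hqb⟩ := JDSVD.exists_chebyshev_residual_polynomial
      (a := δ ^ 2) (b := (σmax + τ) ^ 2) (by positivity) (by gcongr; linarith) (j / 2)
    rw [← div_pow, Real.sqrt_sq (by positivity)] at hqb
    have hbound (x : ℝ) (h1 : δ ≤ |x|) (h2 : |x| ≤ σmax + τ) : |eval x (q.comp (X ^ 2))| ≤
        2 * (1 - 2 / (1 + (σmax + τ) / δ)) ^ (j / 2) := by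
      rw [eval_comp, eval_pow, eval_X, ← sq_abs]
      exact hqb _ (by gcongr) (by gcongr)
    refine key (p := q.comp (X ^ 2)) ?_ (by simp [hq0]) (fun i hi => ?_) (fun _ => ?_)
    · rw [natDegree_comp, natDegree_X_pow]
      omega
    · have hs : δ ≤ |σ i - τ| := hσ _ _ hi
      have hs' := hmax i
      have hs0 := hnn i
      have e : |-σ i - τ| = σ i + τ := by rw [abs_of_nonpos (by linarith)]; ring
      refine ⟨hbound _ hs (abs_le.2 ⟨by linarith, by linarith⟩), hbound _ ?_ ?_⟩
      · rw [e]; linarith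
      · rw [e]; linarith
    · have e : |-τ| = τ := by rw [abs_neg, abs_of_nonneg hτ]
      exact hbound _ (by rw [e]; exact hδτ) (by rw [e]; linarith)
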